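/- Let $d\ge 0$ be an integer, $T>0$, $1\le p<\infty$, and let $\mathrm{Conv}(\mathbb R^d)$ be the family of nonempty compact convex subsets of $\mathbb R^d$ (Euclidean norm) with the Hausdorff metric. For a function $f$ from $[0,T]$ to a metric space $(E,\rho)$ let $$V_p(f)=\sup\sum_{i=1}^{n}\frac{\rho(f(t_{i-1}),f(t_i))^p}{(t_i-t_{i-1})^{p-1}},$$ the supremum being over all partitions $0=t_0<t_1<\dots<t_n=T$, and let $BV_p(E)$ be the set of all $f$ with $V_p(f)<\infty$. For $A,B\in\mathrm{Conv}(\mathbb R^d)$, the Hukuhara difference $A\div B$ is the set $C\in\mathrm{Conv}(\mathbb R^d)$ with $A=B+C$, if it exists. A map $F:[0,T]\to\mathrm{Conv}(\mathbb R^d)$ is Hukuhara differentiable if for every $t\in[0,T]$ there is $D_HF(t)\in\mathrm{Conv}(\mathbb R^d)$ such that, for all small $h>0$, the differences $F(t+h)\div F(t)$ and $F(t)\div F(t-h)$ exist, and their quotients by $h$ converge to $D_HF(t)$ in the Hausdorff metric as $h\to0+$ (only the first at $t=0$, only the second at $t=T$). For $\Phi:[0,T]\to\mathrm{Conv}(\mathbb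 R^d)$ put $S_{V_p}(\Phi)=\{f\in BV_p(\mathbb R^d): f(t)\in \Phi(t)\ \forall t\in[0,T]\}$ and $S_{L^p}(\Phi)=\{\phi\in L^p([0,T],\mathbb R^d):\phi(t)\in\Phi(t)\text{ for a.e. }t\}$. A set $\Lambda\subset BV_p(\mathbb R^d)$ is $V_p$-decomposable if for all $f_1,f_2\in\Lambda$ and $a\in[0,T]$ the function $$t\mapsto f_1(0)+\int_0^t\big(\mathbf 1_{[0,a)}(s)f_1'(s)+\mathbf 1_{[a,T]}(s)f_2'(s)\big)\,ds$$ belongs to $\Lambda$. It is an integral if there are $y\in\mathbb R^d$ and a measurable $\Phi:[0,T]\to\mathrm{Conv}(\mathbb R^d)$ that is $p$-integrably bounded (for some $g\in L^p([0,T])$, $\sup_{x\in\Phi(t)}\|x\|\le g(t)$ for a.e. $t$) such that $$\Lambda=\Big\{f\in BV_p(\mathbb R^d): f(t)=y+\int_0^t\phi(s)\,ds\ \ (t\in[0,T])\text{ for some }\phi\in S_{L^p}(\Phi)\Big\}.$$ **Theorem.** Let $F\in BV_p(\mathrm{Conv}(\mathbb R^d))$ be Hukuhara differentiable with $F(0)=\{x_0\}$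 for some $x_0\in\mathbb R^d$. Then the set $$\mathcal{IS}(F)=\{f\in S_{V_p}(F): f'\in S_{L^p}(D_HF)\}$$ is $V_p$-decomposable. If moreover $p>1$, then $\mathcal{IS}(F)$ is an integral. -/

import Mathlib

open Set Filter Topology MeasureTheory
open scoped ENNReal Pointwise

/-! Functions on the interval `[0,T]` are represented by functions on `ℝ`; every notion below only
looks at the values on `[0,T]`.  `Conv(E)`, the nonempty compact convex subsets of `E` with the
Minkowski operations and the Hausdorff metric, is Mathlib's `ConvexBody E`. -/

noncomputable section

/-- Riesz `p`-variation of `f` on `[a,b]`: the supremum over all partitions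
`a = t₀ < t₁ < ⋯ < tₙ = b` of `∑ d(f(tᵢ), f(tᵢ₊₁)) ^ p / (tᵢ₊₁ - tᵢ) ^ (p - 1)`. -/
def rieszVariation {X : Type*} [PseudoMetricSpace X] (p : ℝ) (f : ℝ → X) (a b : ℝ) : ℝ≥0∞ :=
  ⨆ (n : ℕ) (t : ℕ → ℝ) (_ : t 0 = a ∧ t n = b ∧ ∀ i < n, t i < t (i + 1)),
    ∑ i ∈ Finset.range n,
      ENNReal.ofReal (dist (f (t i)) (f (t (i + 1))) ^ p / (t (i + 1) - t i) ^ (p - 1))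

/-- The functions on `[0,T]` of bounded Riesz `p`-variation. -/
def RieszBV {X : Type*} [PseudoMetricSpace X] (T p : ℝ) : Set (ℝ → X) :=
  {f | rieszVariation p f 0 T < ∞}

variable {E : Type*} [NormedAddCommGroup E] [NormedSpace ℝ E]

/-- The selections of `F` on `[0,T]` of bounded Riesz `p`-variation. -/
def selectionsBV (T p : ℝ) (F : ℝ → ConvexBody E) : Set (ℝ → E) :=
  {f | f ∈ RieszBV T p ∧ ∀ t ∈ Icc 0 T, f t ∈ F t}

/-- The `L^p` selections of `Φ` on `[0,T]`. -/
def selectionsLp (T p : ℝ) (Φ : ℝ → ConvexBody E) : Set (ℝ → E) :=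
  {φ | MemLp φ (ENNReal.ofReal p) (volume.restrict (Icc 0 T)) ∧
    ∀ᵐ t ∂volume.restrict (Icc 0 T), φ t ∈ Φ t}

/-- Measurability of a set-valued function on `[0,T]`: the set of `t` at which `Φ t` meets a
given open set is always a Borel set. -/
def MeasurableBodies (T : ℝ) (Φ : ℝ → ConvexBody E) : Prop :=
  ∀ U : Set E, IsOpen U → MeasurableSet {t | t ∈ Icc 0 T ∧ ((Φ t : Set E) ∩ U).Nonempty}

/-- `Φ` is `p`-integrably bounded on `[0,T]`. -/
def IntegrablyBounded (T p : ℝ) (Φ : ℝ → ConvexBody E) : Prop :=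
  ∃ g : ℝ → ℝ, MemLp g (ENNReal.ofReal p) (volume.restrict (Icc 0 T)) ∧
    ∀ᵐ t ∂volume.restrict (Icc 0 T), ∀ x ∈ Φ t, ‖x‖ ≤ g t

/-- `C` is the Hukuhara difference of `A` and `B`. -/
def IsHukuharaDifference (A B C : ConvexBody E) : Prop :=
  A = B + C

/-- `D` is the Hukuhara derivative at `t ∈ [0,T]` of the set-valued function `F` on `[0,T]`: for
all small `h > 0` the Hukuhara differences of `F (t + h)` and `F t`, and of `F t` and `F (t - h)`,
exist, and their quotients by `h` tend to `D` in the Hausdorff metric as `h → 0+`.  At the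
endpoints `0` and `T` only the one-sided condition that makes sense is required. -/
def HasHukuharaDerivOn (T : ℝ) (F : ℝ → ConvexBody E) (D : ConvexBody E) (t : ℝ) : Prop :=
  (t < T → ∃ C : ℝ → ConvexBody E,
    (∀ᶠ h in 𝓝[>] (0 : ℝ), IsHukuharaDifference (F (t + h)) (F t) (C h)) ∧
      Tendsto (fun h : ℝ => h⁻¹ • C h) (𝓝[>] 0) (𝓝 D)) ∧
  (0 < t → ∃ C : ℝ → ConvexBody E,
    (∀ᶠ h in 𝓝[>] (0 : ℝ), IsHukuharaDifference (F t) (F (t - h)) (C h)) ∧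
      Tendsto (fun h : ℝ => h⁻¹ • C h) (𝓝[>] 0) (𝓝 D))

/-- The concatenation `f₁ ⊕ₐ f₂`:
`t ↦ f₁(0) + ∫₀ᵗ (1_{[0,a)}(s) f₁'(s) + 1_{[a,T]}(s) f₂'(s)) ds`. -/
def rieszConcat (T a : ℝ) (f₁ f₂ : ℝ → E) : ℝ → E := fun t =>
  f₁ 0 + ∫ s in (0 : ℝ)..t,
    ((Ico 0 a).indicator (derivWithin f₁ (Icc 0 T)) s +
      (Icc a T).indicator (derivWithin f₂ (Icc 0 T)) s)

/-- `V_p`-decomposability of a set of functions of bounded Riesz `p`-variation. -/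
def IsVpDecomposable (T p : ℝ) (Λ : Set (ℝ → E)) : Prop :=
  Λ ⊆ RieszBV T p ∧ ∀ f₁ ∈ Λ, ∀ f₂ ∈ Λ, ∀ a ∈ Icc 0 T, rieszConcat T a f₁ f₂ ∈ Λ

/-- `R` is an integral: `R = x₀ + ∫ Φ(s) ds` for some point `x₀` and some measurable and
`p`-integrably bounded `Φ : [0,T] → Conv(E)`. -/
def IsSetIntegral (T p : ℝ) (R : Set (ℝ → E)) : Prop :=
  ∃ (x₀ : E) (Φ : ℝ → ConvexBody E), MeasurableBodies T Φ ∧ IntegrablyBounded T p Φ ∧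
    R = {f | f ∈ RieszBV T p ∧
      ∃ φ ∈ selectionsLp T p Φ, ∀ t ∈ Icc 0 T, f t = x₀ + ∫ s in (0 : ℝ)..t, φ s}

/-- The set `IS(F)`, where `DF` is the Hukuhara derivative of `F`: the selections of `F` of bounded
Riesz `p`-variation whose derivative is an `L^p` selection of `DF`. -/
def selectionsIS (T p : ℝ) (F DF : ℝ → ConvexBody E) : Set (ℝ → E) :=
  {f | f ∈ selectionsBV T p F ∧ derivWithin f (Icc 0 T) ∈ selectionsLp T p DF}

end

/-! Support functions turn the set-valued problem into a scalar one. Write h_A(u) for the maximum of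
⟨u, x⟩ over x ∈ A. Since h is additive under Minkowski sums and continuous in the Hausdorff metric,
Hukuhara differentiability of F makes t ↦ h_{F(t)}(u) differentiable at every t ∈ [0,T], with
derivative h_{DF(t)}(u). This function inherits bounded Riesz p-variation from F, so its derivative
is in L^p, and the fundamental theorem of calculus gives ∫₀ᵗ h_{DF(s)}(u) ds = h_{F(t)}(u) -
h_{F(0)}(u).

If g is an L^p selection of DF and x ∈ F(0), integrating ⟨u, g⟩ ≤ h_{DF}(u) yields ⟨u, x + ∫₀ᵗ g⟩ ≤
h_{F(t)}(u) for every u, and Hahn–Banach puts x + ∫₀ᵗ g in F(t)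
(`add_integral_mem_of_hukuharaDeriv`). Hence every such primitive is in IS(F). A concatenation of
two members is one of these primitives, which is decomposability for all p ≥ 1.

To be an integral, IS(F) must consist only of such primitives. For p > 1 bounded Riesz p-variation
forces f to be the integral of its a.e. derivative (`RieszBV.integral_deriv`); for p = 1 singular
functions such as Cantor's obstruct this. The integrand is DF itself, whose measurability and
p-integrable bound are again read off from its support functions. -/

noncomputable section

/-! ### Support functions of convex bodies and Hukuhara derivatives -/

section Support

variable {V : Type*} [NormedAddCommGroup V] [InnerProductSpace ℝ V]

/-- The support function of a convex body in direction `u`. -/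
def ConvexBody.support (A : ConvexBody V) (u : V) : ℝ :=
  sSup ((fun x => inner ℝ u x) '' (A : Set V))

namespace ConvexBody

theorem exists_support (A : ConvexBody V) (u : V) :
    ∃ x ∈ A, inner ℝ u x = A.support u ∧ ∀ y ∈ A, inner ℝ u y ≤ A.support u := by
  obtain ⟨x, hx, h, h'⟩ := A.isCompact.exists_sSup_image_eq_and_ge A.nonempty
    (f := fun x => inner ℝ u x) (by fun_prop)
  exact ⟨x, hx, h.symm, fun y hy => (h' y hy).trans_eq h.symm⟩

theorem inner_le_support (A : ConvexBody V) (u : V) {x : V} (hx : x ∈ A) :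
    inner ℝ u x ≤ A.support u :=
  (A.exists_support u).choose_spec.2.2 x hx

theorem support_le {A : ConvexBody V} {u : V} {c : ℝ} (h : ∀ x ∈ A, inner ℝ u x ≤ c) :
    A.support u ≤ c := by
  obtain ⟨x, hx, hxu, -⟩ := A.exists_support u
  exact hxu ▸ h x hx

theorem support_add (A B : ConvexBody V) (u : V) :
    (A + B).support u = A.support u + B.support u := by
  apply le_antisymm
  · refine support_le fun z hz => ?_
    obtain ⟨x, hx, y, hy, rfl⟩ := Set.mem_add.1 (show z ∈ (A : Set V) + B from hz)
    rw [inner_add_right]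
    exact add_le_add (A.inner_le_support u hx) (B.inner_le_support u hy)
  · obtain ⟨x, hx, hxu, -⟩ := A.exists_support u
    obtain ⟨y, hy, hyu, -⟩ := B.exists_support u
    rw [← hxu, ← hyu, ← inner_add_right]
    exact (A + B).inner_le_support u (Set.add_mem_add hx hy)

theorem support_smul (A : ConvexBody V) {c : ℝ} (hc : 0 ≤ c) (u : V) :
    (c • A).support u = c * A.support u := by
  apply le_antisymm
  · refine support_le fun z hz => ?_
    obtain ⟨x, hx, rfl⟩ := Set.mem_smul_set.1 (show z ∈ c • (A : Set V) from hz)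
    rw [inner_smul_right]
    exact mul_le_mul_of_nonneg_left (A.inner_le_support u hx) hc
  · obtain ⟨x, hx, hxu, -⟩ := A.exists_support u
    rw [← hxu, ← inner_smul_right]
    exact (c • A).inner_le_support u (Set.smul_mem_smul_set hx)

/-- Hahn–Banach separates a point outside A from A, and the Riesz representation of the separating
functional is the violated direction u. -/
theorem mem_iff_inner_le_support [CompleteSpace V] (A : ConvexBody V) (x : V) :
    x ∈ A ↔ ∀ u, inner ℝ u x ≤ A.support u := by
  refine ⟨fun hx u => A.inner_le_support u hx, fun h => ?_⟩
  by_contra hx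
  obtain ⟨f, c, hc, hfx⟩ := geometric_hahn_banach_closed_point A.convex A.isClosed hx
  have hf (y : V) : inner ℝ ((InnerProductSpace.toDual ℝ V).symm f) y = f y :=
    InnerProductSpace.toDual_symm_apply
  have h1 := h ((InnerProductSpace.toDual ℝ V).symm f)
  have h2 : A.support ((InnerProductSpace.toDual ℝ V).symm f) ≤ c :=
    support_le fun y hy => (hf y).trans_le (hc y hy).le
  rw [hf] at h1
  linarith

theorem support_sub_le (A B : ConvexBody V) (u : V) :
    A.support u - B.support u ≤ ‖u‖ * dist A B := by
  obtain ⟨x, hx, hxu, -⟩ := A.exists_support u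
  refine le_of_forall_pos_le_add fun ε hε => ?_
  -- Adding 1 keeps the denominator positive when u = 0, and ‖u‖ times this slack is still at most
  -- ε.
  have hδ : 0 < ε / (‖u‖ + 1) := by positivity
  obtain ⟨y, hy, hxy⟩ := Metric.exists_dist_lt_of_hausdorffDist_lt (s := (A : Set V)) (t := B)
    (r := dist A B + ε / (‖u‖ + 1)) hx (by rw [hausdorffDist_coe]; linarith) hausdorffEDist_ne_top
  have h1 := B.inner_le_support u hy
  have h2 : inner ℝ u x - inner ℝ u y ≤ ‖u‖ * dist x y := by
    rw [← inner_sub_right, dist_eq_norm]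
    exact real_inner_le_norm _ _
  have h3 : ‖u‖ * dist x y ≤ ‖u‖ * (dist A B + ε / (‖u‖ + 1)) := by gcongr
  have h4 : ‖u‖ * (ε / (‖u‖ + 1)) ≤ ε := by
    rw [mul_div_assoc', div_le_iff₀ (by positivity)]
    nlinarith [norm_nonneg u]
  linarith [mul_add ‖u‖ (dist A B) (ε / (‖u‖ + 1))]

theorem abs_support_sub_le (A B : ConvexBody V) (u : V) :
    |A.support u - B.support u| ≤ ‖u‖ * dist A B :=
  abs_sub_le_iff.2 ⟨A.support_sub_le B u, dist_comm A B ▸ B.support_sub_le A u⟩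

theorem continuous_support_left (u : V) : Continuous fun A : ConvexBody V => A.support u :=
  (LipschitzWith.of_dist_le_mul (K := ‖u‖₊) fun A B => A.abs_support_sub_le B u).continuous

theorem continuous_support (A : ConvexBody V) : Continuous A.support := by
  obtain ⟨M, hM, hA⟩ := A.isBounded.exists_pos_norm_le
  have key (u v : V) : A.support u - A.support v ≤ M * dist u v := by
    obtain ⟨x, hx, hxu, -⟩ := A.exists_support u
    have h1 := A.inner_le_support v hx
    have h2 : inner ℝ u x - inner ℝ v x ≤ dist u v * M := by
      rw [← inner_sub_left, dist_eq_norm]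
      exact (real_inner_le_norm _ _).trans (by gcongr; exact hA x hx)
    linarith
  refine (LipschitzWith.of_dist_le_mul (K := ⟨M, hM.le⟩) fun u v => abs_le.2 ⟨?_, key u v⟩).continuous
  have := key v u
  rw [dist_comm] at this
  change -(M * dist u v) ≤ _
  linarith

/-- A meets the closed ball exactly when c lies in the Minkowski sum of A and the r-ball about 0,
whose support function is h_A + r‖·‖. This reduces measurability of a multifunction to that of its
support functions. -/
theorem inter_closedBall_nonempty_iff [CompleteSpace V] [ProperSpace V] (A : ConvexBody V) (c : V)
    {r : ℝ} (hr : 0 ≤ r) :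
    ((A : Set V) ∩ Metric.closedBall c r).Nonempty ↔
      ∀ u, 0 ≤ A.support u - inner ℝ u c + r * ‖u‖ := by
  constructor
  · rintro ⟨x, hx, hxc⟩ u
    have h1 := A.inner_le_support u hx
    have h2 : inner ℝ u (c - x) ≤ ‖u‖ * ‖c - x‖ := real_inner_le_norm _ _
    have h3 : ‖u‖ * ‖c - x‖ ≤ ‖u‖ * r := by
      gcongr
      rwa [← dist_eq_norm, dist_comm]
    rw [inner_sub_right] at h2
    linarith
  · intro h
    let B : ConvexBody V := ⟨Metric.closedBall 0 r, convex_closedBall _ _,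
      isCompact_closedBall _ _, Metric.nonempty_closedBall.2 hr⟩
    have hB (u : V) : r * ‖u‖ ≤ B.support u := by
      rcases eq_or_ne u 0 with rfl | hu
      · have := B.inner_le_support 0 (x := 0) (Metric.mem_closedBall_self hr)
        simpa using this
      · have hu' : ‖u‖ ≠ 0 := norm_ne_zero_iff.2 hu
        have := B.inner_le_support u (x := (r / ‖u‖) • u) (by
          change _ ∈ Metric.closedBall (0 : V) r
          rw [mem_closedBall_zero_iff, norm_smul, norm_div, norm_norm, div_mul_cancel₀ _ hu',
            Real.norm_of_nonneg hr])
        rw [inner_smul_right, real_inner_self_eq_norm_sq] at this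
        convert this using 1
        field_simp
    have hc : c ∈ A + B := by
      rw [mem_iff_inner_le_support]
      intro u
      rw [support_add]
      linarith [h u, hB u]
    obtain ⟨x, hx, y, hy, hxy⟩ := Set.mem_add.1 (show c ∈ (A : Set V) + B from hc)
    refine ⟨x, hx, ?_⟩
    have hy' : ‖y‖ ≤ r := mem_closedBall_zero_iff.1 hy
    rw [Metric.mem_closedBall, dist_eq_norm, ← hxy]
    simpa using hy'

end ConvexBody

/-- By additivity the difference quotient of the support function is the support function of the
rescaled Hukuhara difference, and continuity of A ↦ h_A(u) passes to the limit. The two sides are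
treated separately and glued. -/
theorem HasHukuharaDerivOn.hasDerivWithinAt_support {T t : ℝ} {F : ℝ → ConvexBody V}
    {D : ConvexBody V} (hT : 0 < T) (h : HasHukuharaDerivOn T F D t) (ht : t ∈ Icc 0 T) (u : V) :
    HasDerivWithinAt (fun s => (F s).support u) (D.support u) (Icc 0 T) t := by
  have right (h1 : t < T) :
      HasDerivWithinAt (fun s => (F s).support u) (D.support u) (Ici t) t := by
    obtain ⟨C, hC, hlim⟩ := h.1 h1
    rw [← hasDerivWithinAt_Ioi_iff_Ici, hasDerivWithinAt_iff_tendsto_slope' self_notMem_Ioi]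
    have h2 := ((ConvexBody.continuous_support_left u).tendsto D).comp hlim
    have h3 : Tendsto (fun s => s - t) (𝓝[>] t) (𝓝[>] 0) := by
      refine tendsto_nhdsWithin_iff.2 ⟨?_, ?_⟩
      · have : Tendsto (fun s => s - t) (𝓝 t) (𝓝 (t - t)) := (continuous_sub_right t).tendsto t
        rw [sub_self] at this
        exact this.mono_left nhdsWithin_le_nhds
      · filter_upwards [self_mem_nhdsWithin] with s hs
        exact show 0 < s - t from sub_pos.2 hs
    refine (h2.comp h3).congr' ?_
    filter_upwards [h3.eventually hC, self_mem_nhdsWithin] with s hs hts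
    have hpos : 0 < s - t := sub_pos.2 hts
    have h4 : F s = F t + C (s - t) := by
      have : F (t + (s - t)) = F t + C (s - t) := hs
      rwa [add_sub_cancel] at this
    simp only [Function.comp_apply, slope_def_field, h4, ConvexBody.support_add,
      ConvexBody.support_smul _ (inv_nonneg.2 hpos.le)]
    field_simp
    ring
  have left (h1 : 0 < t) :
      HasDerivWithinAt (fun s => (F s).support u) (D.support u) (Iic t) t := by
    obtain ⟨C, hC, hlim⟩ := h.2 h1
    rw [← hasDerivWithinAt_Iio_iff_Iic, hasDerivWithinAt_iff_tendsto_slope' self_notMem_Iio]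
    have h2 := ((ConvexBody.continuous_support_left u).tendsto D).comp hlim
    have h3 : Tendsto (fun s => t - s) (𝓝[<] t) (𝓝[>] 0) := by
      refine tendsto_nhdsWithin_iff.2 ⟨?_, ?_⟩
      · have : Tendsto (fun s => t - s) (𝓝 t) (𝓝 (t - t)) := (continuous_sub_left t).tendsto t
        rw [sub_self] at this
        exact this.mono_left nhdsWithin_le_nhds
      · filter_upwards [self_mem_nhdsWithin] with s hs
        exact show 0 < t - s from sub_pos.2 hs
    refine (h2.comp h3).congr' ?_
    filter_upwards [h3.eventually hC, self_mem_nhdsWithin] with s hs hts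
    have hpos : 0 < t - s := sub_pos.2 hts
    have h4 : F t = F s + C (t - s) := by
      have : F t = F (t - (t - s)) + C (t - s) := hs
      rwa [sub_sub_cancel] at this
    have h5 : s - t ≠ 0 := by linarith
    have h6 : t - s ≠ 0 := hpos.ne'
    simp only [Function.comp_apply, slope_def_field, h4, ConvexBody.support_add,
      ConvexBody.support_smul _ (inv_nonneg.2 hpos.le)]
    rw [← neg_sub t s]
    field_simp
    ring
  rcases eq_or_lt_of_le ht.1 with h0 | h0
  · exact (right (h0 ▸ hT)).mono fun s hs => h0.symm.trans_le hs.1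
  · rcases eq_or_lt_of_le ht.2 with h1 | h1
    · exact (left h0).mono fun s hs => hs.2.trans_eq h1.symm
    · exact ((left h0).union (right h1)).mono fun s _ => le_total s t

end Support

/-! ### Riesz variation bounds ordinary variation -/

section RieszVariation

variable {X : Type*} [PseudoMetricSpace X]

/-- The contribution of the interval `[x,y]` to the Riesz `p`-variation. -/
def rieszTerm (p : ℝ) (f : ℝ → X) (x y : ℝ) : ℝ≥0∞ :=
  ENNReal.ofReal (dist (f x) (f y) ^ p / (y - x) ^ (p - 1))

theorem rieszTerm_self {p : ℝ} (hp : 1 ≤ p) (f : ℝ → X) (x : ℝ) : rieszTerm p f x x = 0 := by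
  simp [rieszTerm, Real.zero_rpow (by linarith : p ≠ 0)]

/-- Repeated points can be dropped, since a degenerate interval contributes 0 (its numerator is 0 ^
p). -/
theorem exists_strict_partition {p : ℝ} (hp : 1 ≤ p) (f : ℝ → X) (u : ℕ → ℝ) (n : ℕ)
    (hu : ∀ i < n, u i ≤ u (i + 1)) :
    ∃ (m : ℕ) (t : ℕ → ℝ), (t 0 = u 0 ∧ t m = u n ∧ ∀ i < m, t i < t (i + 1)) ∧
      ∑ i ∈ Finset.range n, rieszTerm p f (u i) (u (i + 1)) =
        ∑ i ∈ Finset.range m, rieszTerm p f (t i) (t (i + 1)) := by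
  induction n with
  | zero => exact ⟨0, u, ⟨rfl, rfl, by simp⟩, rfl⟩
  | succ n ih =>
    obtain ⟨m, t, ⟨h0, hm, hlt⟩, hsum⟩ := ih fun i hi => hu i (by lia)
    rcases (hu n (by lia)).eq_or_lt with h | h
    · refine ⟨m, t, ⟨h0, hm.trans h, hlt⟩, ?_⟩
      rw [Finset.sum_range_succ, hsum, h, rieszTerm_self hp, add_zero]
    · refine ⟨m + 1, fun i => if i ≤ m then t i else u (n + 1), ⟨by simpa using h0, by simp, ?_⟩, ?_⟩
      · intro i hi
        rcases (Nat.lt_succ_iff.1 hi).eq_or_lt with rfl | hi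
        · simpa [hm] using h
        · simpa [hi.le, Nat.succ_le_of_lt hi] using hlt i hi
      · rw [Finset.sum_range_succ, Finset.sum_range_succ, hsum]
        congr 1
        · refine Finset.sum_congr rfl fun i hi => ?_
          have hi := Finset.mem_range.1 hi
          simp [hi.le, Nat.succ_le_of_lt hi]
        · simp [hm]

/-- Framing the points by 0 and T gives a weak partition of the whole interval with two more cells,
which only increases the sum. -/
theorem sum_rieszTerm_le {p T : ℝ} (hp : 1 ≤ p) (f : ℝ → X) (u : ℕ → ℝ) (n : ℕ)
    (hu : ∀ i < n, u i ≤ u (i + 1)) (h0 : 0 ≤ u 0) (hn : u n ≤ T) :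
    ∑ i ∈ Finset.range n, rieszTerm p f (u i) (u (i + 1)) ≤ rieszVariation p f 0 T := by
  let v : ℕ → ℝ := fun i => Nat.casesOn i 0 fun i => if i ≤ n then u i else T
  have hv (i : ℕ) : v (i + 1) = if i ≤ n then u i else T := rfl
  obtain ⟨m, t, ht, hsum⟩ := exists_strict_partition hp f v (n + 2) fun i hi => by
    cases i with
    | zero => simpa [v] using h0
    | succ i =>
      rw [hv, hv]
      rcases (show i ≤ n by lia).eq_or_lt with rfl | hi'
      · simpa using hn
      · simpa [hi'.le, Nat.succ_le_of_lt hi'] using hu i hi'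
  have hv2 : v (n + 2) = T := by rw [hv]; simp
  rw [hv2] at ht
  have h1 : ∑ i ∈ Finset.range n, rieszTerm p f (u i) (u (i + 1)) ≤
      ∑ i ∈ Finset.range (n + 2), rieszTerm p f (v i) (v (i + 1)) := by
    rw [Finset.sum_range_succ', Finset.sum_range_succ, add_assoc]
    refine le_add_right (Finset.sum_le_sum fun i hi => ?_)
    have hi := Finset.mem_range.1 hi
    rw [hv, hv, if_pos hi.le, if_pos (Nat.succ_le_of_lt hi)]
  rw [hsum] at h1
  exact h1.trans (le_iSup_of_le m (le_iSup_of_le t (le_iSup_of_le ht le_rfl)))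

/-- Either the increment d is at most the length ℓ, or d > ℓ and d ≤ d·(d/ℓ)^(p-1). Summing shows
that bounded Riesz variation implies bounded variation, hence a.e. differentiability in finite
dimension. -/
theorem edist_le_rieszTerm_add {p : ℝ} (hp : 1 ≤ p) (f : ℝ → X) {x y : ℝ} (hxy : x ≤ y) :
    edist (f x) (f y) ≤ rieszTerm p f x y + ENNReal.ofReal (y - x) := by
  rcases hxy.eq_or_lt with rfl | h
  · simp
  have hy : 0 < y - x := sub_pos.2 h
  rw [edist_dist, rieszTerm, ← ENNReal.ofReal_add (by positivity) hy.le]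
  apply ENNReal.ofReal_le_ofReal
  rcases le_or_gt (dist (f x) (f y)) (y - x) with h' | h'
  · have : 0 ≤ dist (f x) (f y) ^ p / (y - x) ^ (p - 1) := by positivity
    linarith
  · have hd : 0 < dist (f x) (f y) := hy.trans h'
    have h1 : (y - x) ^ (p - 1) ≤ dist (f x) (f y) ^ (p - 1) :=
      Real.rpow_le_rpow hy.le h'.le (by linarith)
    have h2 : dist (f x) (f y) ≤ dist (f x) (f y) ^ p / (y - x) ^ (p - 1) := by
      rw [le_div_iff₀ (by positivity)]
      calc _ ≤ dist (f x) (f y) * dist (f x) (f y) ^ (p - 1) := by gcongr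
        _ = dist (f x) (f y) ^ p := by
          rw [Real.rpow_sub_one hd.ne']
          field_simp
    linarith

theorem RieszBV.boundedVariationOn {p T : ℝ} (hp : 1 ≤ p) {f : ℝ → X} (hf : f ∈ RieszBV T p) :
    BoundedVariationOn f (Icc 0 T) := by
  refine ne_top_of_le_ne_top
    (ENNReal.add_ne_top.2 ⟨ne_of_lt hf, (ENNReal.ofReal_ne_top : ENNReal.ofReal T ≠ ⊤)⟩) ?_
  refine iSup_le fun ⟨n, u, hu, hmem⟩ => ?_
  have hmono (i : ℕ) : u i ≤ u (i + 1) := hu (Nat.le_succ i)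
  have hlen : ∑ i ∈ Finset.range n, ENNReal.ofReal (u (i + 1) - u i) ≤ ENNReal.ofReal T := by
    rw [← ENNReal.ofReal_sum_of_nonneg fun i _ => sub_nonneg.2 (hmono i), Finset.sum_range_sub]
    exact ENNReal.ofReal_le_ofReal (by linarith [(hmem n).2, (hmem 0).1])
  calc ∑ i ∈ Finset.range n, edist (f (u (i + 1))) (f (u i))
      ≤ ∑ i ∈ Finset.range n,
          (rieszTerm p f (u i) (u (i + 1)) + ENNReal.ofReal (u (i + 1) - u i)) :=
        Finset.sum_le_sum fun i _ => by
          rw [edist_comm]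
          exact edist_le_rieszTerm_add hp f (hmono i)
    _ ≤ rieszVariation p f 0 T + ENNReal.ofReal T := by
        rw [Finset.sum_add_distrib]
        exact add_le_add
          (sum_rieszTerm_le hp f u n (fun i _ => hmono i) (hmem 0).1 (hmem n).2) hlen

end RieszVariation

/-- Hölder on a small set s: the L¹ norm there is at most C · μ(s)^(1 - 1/q), with a positive
exponent because q > 1. -/
theorem unifIntegrable_one_of_eLpNorm_le {α ι W : Type*} [NormedAddCommGroup W]
    [MeasurableSpace α] {μ : Measure α}
    {q : ℝ≥0∞} (hq : 1 < q) {f : ι → α → W} (hf : ∀ i, AEStronglyMeasurable (f i) μ)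
    {C : ℝ≥0∞} (hC : C ≠ ⊤) (hfC : ∀ i, eLpNorm (f i) q μ ≤ C) : UnifIntegrable f 1 μ := by
  intro ε hε
  set r : ℝ := 1 / (1 : ℝ≥0∞).toReal - 1 / q.toReal with hr
  have hr0 : 0 < r := by
    rcases eq_or_ne q ⊤ with rfl | hq'
    · simp [hr]
    · have : 1 < q.toReal := by
        rw [← ENNReal.toReal_one]
        exact ENNReal.toReal_strict_mono hq' hq
      rw [hr, ENNReal.toReal_one, div_one, sub_pos, div_lt_one (by linarith)]
      exact this
  have hlim : Tendsto (fun δ : ℝ => C * ENNReal.ofReal δ ^ r) (𝓝 0) (𝓝 0) := by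
    have h1 : Tendsto (fun δ : ℝ => ENNReal.ofReal δ ^ r) (𝓝 0) (𝓝 0) := by
      have := ((ENNReal.continuous_rpow_const (y := r)).comp ENNReal.continuous_ofReal).tendsto 0
      simpa [Function.comp_def, ENNReal.zero_rpow_of_pos hr0] using this
    simpa using ENNReal.Tendsto.const_mul h1 (Or.inr hC)
  have hev := (hlim.eventually (Iic_mem_nhds (ENNReal.ofReal_pos.2 hε))).filter_mono
    (nhdsWithin_le_nhds (s := Ioi 0))
  obtain ⟨δ, hδ, hδ0⟩ := (hev.and self_mem_nhdsWithin).exists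
  refine ⟨δ, hδ0, fun i s hs hμ => ?_⟩
  rw [eLpNorm_indicator_eq_eLpNorm_restrict hs]
  calc eLpNorm (f i) 1 (μ.restrict s)
      ≤ eLpNorm (f i) q (μ.restrict s) * μ.restrict s univ ^ r :=
        eLpNorm_le_eLpNorm_mul_rpow_measure_univ hq.le (hf i).restrict
    _ ≤ C * ENNReal.ofReal δ ^ r := by
        rw [Measure.restrict_apply_univ]
        gcongr
        exact (eLpNorm_mono_measure _ Measure.restrict_le_self).trans (hfC i)
    _ ≤ ENNReal.ofReal ε := hδ

/-! ### Riesz's theorem: the derivative is in L^p and, for p > 1, integrates back to f -/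

section StepSlope

variable {V : Type*} [NormedAddCommGroup V] [NormedSpace ℝ V]

/-- The difference quotient of `f` over the interval of the grid of step `h` containing `s`. -/
def stepSlope (f : ℝ → V) (h s : ℝ) : V :=
  h⁻¹ • (f ((⌊s / h⌋₊ + 1 : ℕ) * h) - f (⌊s / h⌋₊ * h))

theorem stronglyMeasurable_stepSlope (f : ℝ → V) (h : ℝ) : StronglyMeasurable (stepSlope f h) := by
  have h1 : StronglyMeasurable fun k : ℕ => h⁻¹ • (f ((k + 1 : ℕ) * h) - f (k * h)) :=
    .of_discrete
  exact h1.comp_measurable (Nat.measurable_floor.comp (measurable_id.div_const h))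

theorem stepSlope_eq (f : ℝ → V) {h s : ℝ} (hh : 0 < h) (k : ℕ)
    (hs : s ∈ Ico (k * h) ((k + 1 : ℕ) * h)) :
    stepSlope f h s = h⁻¹ • (f ((k + 1 : ℕ) * h) - f (k * h)) := by
  have : ⌊s / h⌋₊ = k := by
    have hs0 : 0 ≤ s := le_trans (by positivity) hs.1
    rw [Nat.floor_eq_iff (by positivity), le_div_iff₀ hh, div_lt_iff₀ hh]
    exact ⟨hs.1, by simpa using hs.2⟩
  rw [stepSlope, this]

theorem Ico_grid_succ {h : ℝ} (hh : 0 < h) (n : ℕ) :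
    Ico 0 ((n + 1 : ℕ) * h) = Ico 0 (n * h) ∪ Ico (n * h) ((n + 1 : ℕ) * h) := by
  rw [Ico_union_Ico_eq_Ico (by positivity) (by push_cast; nlinarith)]

theorem lintegral_stepSlope {p : ℝ} (hp : 1 ≤ p) (f : ℝ → V) {h : ℝ} (hh : 0 < h) (n : ℕ) :
    ∫⁻ s in Ico 0 (n * h), ‖stepSlope f h s‖ₑ ^ p =
      ∑ k ∈ Finset.range n, rieszTerm p f (k * h) ((k + 1 : ℕ) * h) := by
  induction n with
  | zero => simp
  | succ n ih =>
    rw [Ico_grid_succ hh, lintegral_union measurableSet_Ico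
      (Ico_disjoint_Ico_same), ih, Finset.sum_range_succ]
    congr 1
    rw [setLIntegral_congr_fun measurableSet_Ico
      fun s hs => by rw [stepSlope_eq f hh n hs], setLIntegral_const, Real.volume_Ico, rieszTerm,
      ← ofReal_norm, ENNReal.ofReal_rpow_of_nonneg (norm_nonneg _) (by linarith),
      ← ENNReal.ofReal_mul (by positivity), norm_smul, dist_comm, dist_eq_norm, norm_inv,
      Real.norm_of_nonneg hh.le, Real.mul_rpow (by positivity) (norm_nonneg _)]
    have h1 : ((n + 1 : ℕ) : ℝ) * h - n * h = h := by push_cast; ring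
    rw [h1, Real.rpow_sub_one hh.ne', Real.inv_rpow hh.le]
    congr 1
    have : h ^ p ≠ 0 := (Real.rpow_pos_of_pos hh p).ne'
    field_simp

theorem integral_stepSlope [CompleteSpace V] (f : ℝ → V) {h : ℝ} (hh : 0 < h) (n : ℕ) :
    IntegrableOn (stepSlope f h) (Ico 0 (n * h)) ∧
      ∫ s in Ico 0 (n * h), stepSlope f h s = f (n * h) - f 0 := by
  induction n with
  | zero => simp
  | succ n ih =>
    have hcongr : EqOn (stepSlope f h) (fun _ => h⁻¹ • (f ((n + 1 : ℕ) * h) - f (n * h)))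
      (Ico (n * h) ((n + 1 : ℕ) * h)) := fun s hs => stepSlope_eq f hh n hs
    have hint : IntegrableOn (stepSlope f h) (Ico (n * h) ((n + 1 : ℕ) * h)) :=
      (integrableOn_congr_fun hcongr measurableSet_Ico).2
        (integrableOn_const (by simp))
    rw [Ico_grid_succ hh]
    refine ⟨ih.1.union hint, ?_⟩
    rw [setIntegral_union Ico_disjoint_Ico_same measurableSet_Ico ih.1 hint, ih.2,
      setIntegral_congr_fun measurableSet_Ico hcongr, setIntegral_const, Measure.real,
      Real.volume_Ico]
    have h1 : ((n + 1 : ℕ) : ℝ) * h - n * h = h := by push_cast; ring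
    rw [h1, ENNReal.toReal_ofReal hh.le, smul_inv_smul₀ hh.ne']
    abel

/-- The straddle lemma: the linearisation errors at a and b are o(s - a) and o(b - s), and these
lengths add up to b - a because s lies between the endpoints. -/
theorem HasDerivWithinAt.tendsto_straddle {ι : Type*} {l : Filter ι} {f : ℝ → V} {f' : V}
    {S : Set ℝ} {s : ℝ} (hf : HasDerivWithinAt f f' S s) {a b : ι → ℝ}
    (ha : Tendsto a l (𝓝 s)) (hb : Tendsto b l (𝓝 s))
    (hab : ∀ᶠ i in l, a i ∈ S ∧ b i ∈ S ∧ a i ≤ s ∧ s ≤ b i ∧ a i < b i) :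
    Tendsto (fun i => (b i - a i)⁻¹ • (f (b i) - f (a i))) l (𝓝 f') := by
  rw [Metric.tendsto_nhds]
  intro ε hε
  have ha' : Tendsto a l (𝓝[S] s) := tendsto_nhdsWithin_iff.2 ⟨ha, hab.mono fun i h => h.1⟩
  have hb' : Tendsto b l (𝓝[S] s) := tendsto_nhdsWithin_iff.2 ⟨hb, hab.mono fun i h => h.2.1⟩
  have ho := (hasDerivWithinAt_iff_isLittleO.1 hf).def (half_pos hε)
  filter_upwards [ha'.eventually ho, hb'.eventually ho, hab] with i h1 h2 ⟨_, _, h3, h4, h5⟩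
  have hpos : 0 < b i - a i := sub_pos.2 h5
  rw [Real.norm_of_nonpos (by linarith)] at h1
  rw [Real.norm_of_nonneg (by linarith)] at h2
  have key : (b i - a i)⁻¹ • (f (b i) - f (a i)) - f' = (b i - a i)⁻¹ •
      ((f (b i) - f s - (b i - s) • f') - (f (a i) - f s - (a i - s) • f')) := by
    have : (f (b i) - f s - (b i - s) • f') - (f (a i) - f s - (a i - s) • f') =
        (f (b i) - f (a i)) - (b i - a i) • f' := by
      simp only [sub_smul]; abel
    rw [this, smul_sub _ (f (b i) - f (a i)), inv_smul_smul₀ hpos.ne']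
  rw [dist_eq_norm, key, norm_smul, norm_inv, Real.norm_of_nonneg hpos.le, inv_mul_lt_iff₀ hpos]
  calc _ ≤ _ := norm_sub_le _ _
    _ ≤ ε / 2 * (b i - s) + ε / 2 * -(a i - s) := add_le_add h2 h1
    _ < (b i - a i) * ε := by nlinarith

/-- The step b/(n+1) divides [0,b] exactly, so the cell around any s < b stays inside [0,T]. -/
theorem tendsto_stepSlope {f : ℝ → V} {f' : V} {T b s : ℝ} (hbT : b ≤ T)
    (hs : s ∈ Ico 0 b) (hf : HasDerivWithinAt f f' (Icc 0 T) s) :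
    Tendsto (fun n : ℕ => stepSlope f (b / (n + 1 : ℕ)) s) atTop (𝓝 f') := by
  have hb : 0 < b := hs.1.trans_lt hs.2
  have hh (n : ℕ) : 0 < b / (n + 1 : ℕ) := by positivity
  have hlim : Tendsto (fun n : ℕ => b / (n + 1 : ℕ)) atTop (𝓝 0) :=
    (tendsto_const_div_atTop_nhds_zero_nat b).comp (tendsto_add_atTop_nat 1)
  have hle (n : ℕ) : ⌊s / (b / (n + 1 : ℕ))⌋₊ * (b / (n + 1 : ℕ)) ≤ s := by
    rw [← le_div_iff₀ (hh n)]
    exact Nat.floor_le (div_nonneg hs.1 (hh n).le)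
  have hlt (n : ℕ) : s < (⌊s / (b / (n + 1 : ℕ))⌋₊ + 1 : ℕ) * (b / (n + 1 : ℕ)) := by
    rw [← div_lt_iff₀ (hh n)]
    exact_mod_cast Nat.lt_floor_add_one _
  have hdiff (n : ℕ) : ((⌊s / (b / (n + 1 : ℕ))⌋₊ + 1 : ℕ) : ℝ) * (b / (n + 1 : ℕ)) =
      ⌊s / (b / (n + 1 : ℕ))⌋₊ * (b / (n + 1 : ℕ)) + b / (n + 1 : ℕ) := by
    push_cast; ring
  have ha : Tendsto (fun n : ℕ => ⌊s / (b / (n + 1 : ℕ))⌋₊ * (b / (n + 1 : ℕ))) atTop (𝓝 s) := by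
    refine tendsto_of_tendsto_of_tendsto_of_le_of_le (g := fun n : ℕ => s - b / (n + 1 : ℕ))
      (by simpa using hlim.const_sub s) tendsto_const_nhds (fun n => ?_) hle
    have := hlt n
    rw [hdiff] at this
    change s - b / (n + 1 : ℕ) ≤ _
    linarith
  have hb' : Tendsto (fun n : ℕ => ((⌊s / (b / (n + 1 : ℕ))⌋₊ + 1 : ℕ) : ℝ) * (b / (n + 1 : ℕ)))
      atTop (𝓝 s) := by
    simp_rw [hdiff]
    simpa using ha.add hlim
  refine (hf.tendsto_straddle ha hb' (Eventually.of_forall fun n => ?_)).congr fun n => ?_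
  · have hk : ⌊s / (b / (n + 1 : ℕ))⌋₊ + 1 ≤ n + 1 := by
      refine Nat.succ_le_of_lt ((Nat.floor_lt (div_nonneg hs.1 (hh n).le)).2 ?_)
      rw [div_lt_iff₀ (hh n), mul_div_cancel₀ _ (by positivity)]
      exact hs.2
    have hup : ((⌊s / (b / (n + 1 : ℕ))⌋₊ + 1 : ℕ) : ℝ) * (b / (n + 1 : ℕ)) ≤ T := by
      refine le_trans ?_ hbT
      calc _ ≤ ((n + 1 : ℕ) : ℝ) * (b / (n + 1 : ℕ)) := by gcongr
        _ = b := mul_div_cancel₀ _ (by positivity)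
    have h0 := hh n
    exact ⟨⟨by positivity, (hle n).trans (hs.2.le.trans hbT)⟩, ⟨by positivity, hup⟩, hle n,
      (hlt n).le, (hle n).trans_lt (hlt n)⟩
  · rw [stepSlope, hdiff, add_sub_cancel_left]

theorem eLpNorm_stepSlope_le {p T b : ℝ} (hp : 1 ≤ p) (f : ℝ → V) (hb : 0 < b) (hbT : b ≤ T)
    (n : ℕ) :
    eLpNorm (stepSlope f (b / (n + 1 : ℕ))) (ENNReal.ofReal p) (volume.restrict (Ico 0 b)) ≤
      rieszVariation p f 0 T ^ (1 / p) := by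
  have hp0 : 0 < p := by linarith
  rw [eLpNorm_eq_lintegral_rpow_enorm_toReal (by simpa using hp0) ENNReal.ofReal_ne_top,
    ENNReal.toReal_ofReal hp0.le]
  gcongr
  have hh : 0 < b / (n + 1 : ℕ) := by positivity
  have hn : ((n + 1 : ℕ) : ℝ) * (b / (n + 1 : ℕ)) = b := mul_div_cancel₀ _ (by positivity)
  have h1 := lintegral_stepSlope hp f hh (n + 1)
  rw [hn] at h1
  rw [h1]
  refine sum_rieszTerm_le hp f (fun k : ℕ => k * (b / (n + 1 : ℕ))) (n + 1) (fun i _ => ?_)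
    (by simp) (hn.trans_le hbT)
  have : (i : ℝ) ≤ (i + 1 : ℕ) := by push_cast; linarith
  change (i : ℝ) * _ ≤ ((i + 1 : ℕ) : ℝ) * _
  gcongr

theorem ae_tendsto_stepSlope {T b : ℝ} {f f' : ℝ → V} (hbT : b ≤ T)
    (hd : ∀ᵐ t ∂volume.restrict (Icc 0 T), HasDerivWithinAt f (f' t) (Icc 0 T) t) :
    ∀ᵐ t ∂volume.restrict (Ico 0 b),
      Tendsto (fun n : ℕ => stepSlope f (b / (n + 1 : ℕ)) t) atTop (𝓝 (f' t)) := by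
  have hsub : Ico 0 b ⊆ Icc 0 T := fun t ht => ⟨ht.1, ht.2.le.trans hbT⟩
  filter_upwards [ae_restrict_of_ae_restrict_of_subset hsub hd, ae_restrict_mem measurableSet_Ico]
    with t ht hmem using tendsto_stepSlope hbT hmem ht

/-- Fatou's lemma: the step slopes converge a.e. to f', and the p-th powers of their L^p norms are
Riesz sums of f, bounded by its variation. -/
theorem RieszBV.memLp_deriv {p T : ℝ} (hT : 0 < T) (hp : 1 ≤ p) {f f' : ℝ → V}
    (hf : f ∈ RieszBV T p)
    (hd : ∀ᵐ t ∂volume.restrict (Icc 0 T), HasDerivWithinAt f (f' t) (Icc 0 T) t) :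
    MemLp f' (ENNReal.ofReal p) (volume.restrict (Icc 0 T)) := by
  rw [← restrict_Ico_eq_restrict_Icc]
  have hlim := ae_tendsto_stepSlope le_rfl hd
  have hmeas (n : ℕ) : AEStronglyMeasurable (stepSlope f (T / (n + 1 : ℕ)))
      (volume.restrict (Ico 0 T)) := (stronglyMeasurable_stepSlope f _).aestronglyMeasurable
  refine ⟨aestronglyMeasurable_of_tendsto_ae atTop hmeas hlim, ?_⟩
  refine (Lp.eLpNorm_lim_le_liminf_eLpNorm hmeas f' hlim).trans_lt ?_
  refine lt_of_le_of_lt (liminf_le_of_le (by isBoundedDefault) fun c hc => ?_)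
    (ENNReal.rpow_lt_top_of_nonneg (by positivity) (ne_of_lt hf) :
      rieszVariation p f 0 T ^ (1 / p) < ⊤)
  obtain ⟨n, hn⟩ := hc.exists
  exact hn.trans (eLpNorm_stepSlope_le hp f hT le_rfl n)

/-- The integrals of the step slopes telescope to f b - f 0 for every n. An L^p bound with p > 1
makes them uniformly integrable, so Vitali's theorem upgrades a.e. convergence to L¹ convergence. -/
theorem RieszBV.integral_deriv [CompleteSpace V] {p T : ℝ} (hT : 0 < T) (hp : 1 < p)
    {f f' : ℝ → V} (hf : f ∈ RieszBV T p)
    (hd : ∀ᵐ t ∂volume.restrict (Icc 0 T), HasDerivWithinAt f (f' t) (Icc 0 T) t)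
    {b : ℝ} (hb : b ∈ Icc 0 T) : ∫ t in (0 : ℝ)..b, f' t = f b - f 0 := by
  rcases hb.1.eq_or_lt with rfl | hb0
  · simp
  have hL : MemLp f' 1 (volume.restrict (Ico 0 b)) := by
    have hsub : Ico 0 b ⊆ Icc 0 T := fun t ht => ⟨ht.1, ht.2.le.trans hb.2⟩
    refine ((RieszBV.memLp_deriv hT hp.le hf hd).mono_measure
      (Measure.restrict_mono hsub le_rfl)).mono_exponent ?_
    simpa using hp.le
  have hmeas (n : ℕ) : AEStronglyMeasurable (stepSlope f (b / (n + 1 : ℕ)))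
      (volume.restrict (Ico 0 b)) := (stronglyMeasurable_stepSlope f _).aestronglyMeasurable
  have hn (n : ℕ) : ((n + 1 : ℕ) : ℝ) * (b / (n + 1 : ℕ)) = b := mul_div_cancel₀ _ (by positivity)
  have hstep (n : ℕ) := integral_stepSlope f (h := b / (n + 1 : ℕ)) (by positivity) (n + 1)
  simp only [hn] at hstep
  have hui := unifIntegrable_one_of_eLpNorm_le (q := ENNReal.ofReal p) (by simpa using hp) hmeas
    (ENNReal.rpow_ne_top_of_nonneg (by positivity) (ne_of_lt hf) :
      rieszVariation p f 0 T ^ (1 / p) ≠ ⊤) fun n => eLpNorm_stepSlope_le hp.le f hb0 hb.2 n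
  have hlim := tendsto_Lp_finite_of_tendsto_ae le_rfl ENNReal.one_ne_top hmeas hL hui
    (ae_tendsto_stepSlope hb.2 hd)
  have h1 := tendsto_integral_of_L1' f' hL.1
    (Eventually.of_forall fun n => (hstep n).1) hlim
  simp only [(hstep _).2] at h1
  rw [intervalIntegral.integral_of_le hb0.le, ← restrict_Ico_eq_restrict_Ioc]
  exact tendsto_nhds_unique h1 tendsto_const_nhds

end StepSlope

/-! ### Primitives of L^p functions -/

section Primitive

variable {V : Type*} [NormedAddCommGroup V] [NormedSpace ℝ V]

/-- Hölder against the constant 1. Summed over a partition, it bounds the Riesz variation of a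
primitive by the integral of ‖g‖^p. -/
theorem ofReal_norm_integral_rpow_div_le {p x y : ℝ} (hp : 1 ≤ p) (hxy : x < y) {g : ℝ → V}
    (hg : AEStronglyMeasurable g (volume.restrict (Ioc x y))) :
    ENNReal.ofReal (‖∫ s in x..y, g s‖ ^ p / (y - x) ^ (p - 1)) ≤
      ∫⁻ s in Ioc x y, ‖g s‖ₑ ^ p := by
  have hp0 : 0 < p := by linarith
  have hpos : 0 < y - x := sub_pos.2 hxy
  have h1 : ‖∫ s in x..y, g s‖ₑ ≤
      (∫⁻ s in Ioc x y, ‖g s‖ₑ ^ p) ^ (1 / p) * ENNReal.ofReal (y - x) ^ (1 - 1 / p) := by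
    rw [intervalIntegral.integral_of_le hxy.le]
    refine (enorm_integral_le_lintegral_enorm _).trans ?_
    have := eLpNorm_le_eLpNorm_mul_rpow_measure_univ (p := 1) (q := ENNReal.ofReal p)
      (by simpa using hp) hg
    rw [eLpNorm_one_eq_lintegral_enorm, eLpNorm_eq_lintegral_rpow_enorm_toReal
      (by simpa using hp0) ENNReal.ofReal_ne_top, ENNReal.toReal_ofReal hp0.le,
      Measure.restrict_apply_univ, Real.volume_Ioc, ENNReal.toReal_one, div_one] at this
    exact this
  have h2 := ENNReal.rpow_le_rpow h1 hp0.le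
  rw [ENNReal.mul_rpow_of_nonneg _ _ hp0.le, ← ENNReal.rpow_mul, ← ENNReal.rpow_mul,
    one_div_mul_cancel hp0.ne', ENNReal.rpow_one,
    show (1 - 1 / p) * p = p - 1 by field_simp, ← ofReal_norm,
    ENNReal.ofReal_rpow_of_nonneg (norm_nonneg _) hp0.le, ENNReal.ofReal_rpow_of_pos hpos] at h2
  have h3 : 0 < (y - x) ^ (p - 1) := Real.rpow_pos_of_pos hpos _
  rw [ENNReal.ofReal_div_of_pos h3]
  exact ENNReal.div_le_of_le_mul h2

theorem sum_lintegral_Ioc {q : ℝ → ℝ≥0∞} {t : ℕ → ℝ} {n : ℕ} (ht : ∀ i < n, t i ≤ t (i + 1)) :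
    t 0 ≤ t n ∧
      ∑ i ∈ Finset.range n, ∫⁻ s in Ioc (t i) (t (i + 1)), q s = ∫⁻ s in Ioc (t 0) (t n), q s := by
  induction n with
  | zero => simp
  | succ n ih =>
    obtain ⟨h1, h2⟩ := ih fun i hi => ht i (by lia)
    have h3 := ht n (by lia)
    refine ⟨h1.trans h3, ?_⟩
    rw [Finset.sum_range_succ, h2, ← Ioc_union_Ioc_eq_Ioc h1 h3,
      lintegral_union measurableSet_Ioc (Ioc_disjoint_Ioc_of_le le_rfl)]

theorem partition_mem_Icc {a b : ℝ} {t : ℕ → ℝ} {n : ℕ}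
    (ht : t 0 = a ∧ t n = b ∧ ∀ i < n, t i < t (i + 1)) {i : ℕ} (hi : i ≤ n) :
    t i ∈ Icc a b := by
  have hmono : MonotoneOn t (Iic n) := by
    refine monotoneOn_of_le_succ ordConnected_Iic fun j _ _ hj => (ht.2.2 j ?_).le
    exact Nat.lt_of_succ_le hj
  exact ⟨ht.1 ▸ hmono (Nat.zero_le n) hi (Nat.zero_le i), ht.2.1 ▸ hmono hi (le_refl n) hi⟩

theorem intervalIntegrable_of_memLp {W : Type*} [NormedAddCommGroup W] {p T : ℝ} (hp : 1 ≤ p)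
    {g : ℝ → W}
    (hg : MemLp g (ENNReal.ofReal p) (volume.restrict (Icc 0 T))) {x y : ℝ}
    (hx : x ∈ Icc 0 T) (hy : y ∈ Icc 0 T) : IntervalIntegrable g volume x y := by
  have h1 : IntegrableOn g (Icc 0 T) := hg.integrable (by simpa using hp)
  rw [intervalIntegrable_iff]
  refine h1.mono_set (uIoc_subset_uIcc.trans ?_)
  exact ordConnected_Icc.uIcc_subset hx hy

theorem RieszBV.of_primitive {p T : ℝ} (hp : 1 ≤ p) {f g : ℝ → V} {y : V}
    (hg : MemLp g (ENNReal.ofReal p) (volume.restrict (Icc 0 T)))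
    (hf : ∀ t ∈ Icc 0 T, f t = y + ∫ s in (0 : ℝ)..t, g s) : f ∈ RieszBV T p := by
  have hp0 : 0 < p := by linarith
  have hfin : ∫⁻ s in Ioc 0 T, ‖g s‖ₑ ^ p < ⊤ := by
    have := lintegral_rpow_enorm_lt_top_of_eLpNorm_lt_top (by simpa using hp0)
      ENNReal.ofReal_ne_top hg.2
    rwa [ENNReal.toReal_ofReal hp0.le, ← restrict_Ioc_eq_restrict_Icc] at this
  refine lt_of_le_of_lt (iSup_le fun n => iSup_le fun t => iSup_le fun ht => ?_) hfin
  have hsum := (sum_lintegral_Ioc (q := fun s => ‖g s‖ₑ ^ p) fun i hi => (ht.2.2 i hi).le).2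
  rw [ht.1, ht.2.1] at hsum
  rw [← hsum]
  refine Finset.sum_le_sum fun i hi => ?_
  have hi := Finset.mem_range.1 hi
  have m1 := partition_mem_Icc ht hi.le
  have m2 := partition_mem_Icc ht (Nat.succ_le_of_lt hi)
  have m0 : (0 : ℝ) ∈ Icc 0 T := ⟨le_rfl, m1.1.trans m1.2⟩
  have hd : dist (f (t i)) (f (t (i + 1))) = ‖∫ s in t i..t (i + 1), g s‖ := by
    rw [hf _ m1, hf _ m2, dist_add_left, dist_comm, dist_eq_norm,
      intervalIntegral.integral_interval_sub_left (intervalIntegrable_of_memLp hp hg m0 m2)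
        (intervalIntegrable_of_memLp hp hg m0 m1)]
  rw [hd]
  exact ofReal_norm_integral_rpow_div_le hp (ht.2.2 i hi)
    (hg.1.mono_measure (Measure.restrict_mono (Ioc_subset_Icc_self.trans
      (Icc_subset_Icc m1.1 m2.2)) le_rfl))

theorem ae_hasDerivWithinAt_primitive [CompleteSpace V] {p T : ℝ} (hT : 0 < T) (hp : 1 ≤ p)
    {f g : ℝ → V} {y : V} (hg : MemLp g (ENNReal.ofReal p) (volume.restrict (Icc 0 T)))
    (hf : ∀ t ∈ Icc 0 T, f t = y + ∫ s in (0 : ℝ)..t, g s) :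
    ∀ᵐ t ∂volume.restrict (Icc 0 T), HasDerivWithinAt f (g t) (Icc 0 T) t := by
  have h := (intervalIntegrable_of_memLp hp hg (left_mem_Icc.2 hT.le)
    (right_mem_Icc.2 hT.le)).ae_hasDerivAt_integral
  rw [uIcc_of_le hT.le] at h
  rw [ae_restrict_iff' measurableSet_Icc]
  filter_upwards [h] with t ht hmem
  exact ((ht hmem 0 (left_mem_Icc.2 hT.le)).const_add y).hasDerivWithinAt.congr hf (hf t hmem)

theorem ae_derivWithin_primitive [CompleteSpace V] {p T : ℝ} (hT : 0 < T) (hp : 1 ≤ p)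
    {f g : ℝ → V} {y : V} (hg : MemLp g (ENNReal.ofReal p) (volume.restrict (Icc 0 T)))
    (hf : ∀ t ∈ Icc 0 T, f t = y + ∫ s in (0 : ℝ)..t, g s) :
    derivWithin f (Icc 0 T) =ᵐ[volume.restrict (Icc 0 T)] g := by
  filter_upwards [ae_hasDerivWithinAt_primitive hT hp hg hf, ae_restrict_mem measurableSet_Icc]
    with t ht hmem using ht.derivWithin (uniqueDiffOn_Icc hT t hmem)

theorem RieszBV.ae_hasDerivWithinAt [FiniteDimensional ℝ V] {p T : ℝ} (hp : 1 ≤ p) {f : ℝ → V}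
    (hf : f ∈ RieszBV T p) :
    ∀ᵐ t ∂volume.restrict (Icc 0 T), HasDerivWithinAt f (derivWithin f (Icc 0 T) t) (Icc 0 T) t :=
  ((RieszBV.boundedVariationOn hp hf).locallyBoundedVariationOn.ae_differentiableWithinAt
    measurableSet_Icc).mono fun _ h => h.hasDerivWithinAt

end Primitive

/-! ### Selections, decomposability and the integral representation -/

section SetValued

variable {V : Type*} [NormedAddCommGroup V] [InnerProductSpace ℝ V]

theorem RieszBV.support {p T : ℝ} (hp : 1 ≤ p) {F : ℝ → ConvexBody V} (hF : F ∈ RieszBV T p)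
    (u : V) : (fun t => (F t).support u) ∈ RieszBV T p := by
  have hp0 : 0 < p := by linarith
  refine lt_of_le_of_lt (iSup_le fun n => iSup_le fun t => iSup_le fun ht => ?_)
    (ENNReal.mul_lt_top (ENNReal.ofReal_lt_top : ENNReal.ofReal (‖u‖ ^ p) < ⊤) hF)
  calc _ ≤ ∑ i ∈ Finset.range n, ENNReal.ofReal (‖u‖ ^ p) * ENNReal.ofReal
        (dist (F (t i)) (F (t (i + 1))) ^ p / (t (i + 1) - t i) ^ (p - 1)) := by
        refine Finset.sum_le_sum fun i hi => ?_
        have hpos : 0 < t (i + 1) - t i := sub_pos.2 (ht.2.2 i (Finset.mem_range.1 hi))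
        rw [← ENNReal.ofReal_mul (by positivity)]
        apply ENNReal.ofReal_le_ofReal
        rw [← mul_div_assoc, ← Real.mul_rpow (norm_nonneg _) dist_nonneg]
        gcongr
        exact (F (t i)).abs_support_sub_le _ u
    _ ≤ _ := by
        rw [← Finset.mul_sum]
        gcongr
        exact le_iSup_of_le n (le_iSup_of_le t (le_iSup_of_le ht le_rfl))

theorem memLp_support_hukuharaDeriv {p T : ℝ} (hT : 0 < T) (hp : 1 ≤ p) {F DF : ℝ → ConvexBody V}
    (hF : F ∈ RieszBV T p) (hDF : ∀ t ∈ Icc 0 T, HasHukuharaDerivOn T F (DF t) t) (u : V) :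
    MemLp (fun t => (DF t).support u) (ENNReal.ofReal p) (volume.restrict (Icc 0 T)) := by
  refine RieszBV.memLp_deriv hT hp (RieszBV.support hp hF u) ?_
  filter_upwards [ae_restrict_mem measurableSet_Icc] with t ht
  exact (hDF t ht).hasDerivWithinAt_support hT ht u

theorem add_integral_mem_of_hukuharaDeriv [CompleteSpace V] {p T : ℝ} (hT : 0 < T) (hp : 1 ≤ p)
    {F DF : ℝ → ConvexBody V} {g : ℝ → V} {x : V} (hF : F ∈ RieszBV T p)
    (hDF : ∀ t ∈ Icc 0 T, HasHukuharaDerivOn T F (DF t) t) (hx : x ∈ F 0)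
    (hg : g ∈ selectionsLp T p DF) {t : ℝ} (ht : t ∈ Icc 0 T) :
    x + ∫ s in (0 : ℝ)..t, g s ∈ F t := by
  rw [ConvexBody.mem_iff_inner_le_support]
  intro u
  have h0 : (0 : ℝ) ∈ Icc 0 T := left_mem_Icc.2 hT.le
  have hsub : Icc 0 t ⊆ Icc 0 T := Icc_subset_Icc_right ht.2
  have hder (s : ℝ) (hs : s ∈ Icc 0 T) := (hDF s hs).hasDerivWithinAt_support hT hs u
  have hint := intervalIntegrable_of_memLp hp (memLp_support_hukuharaDeriv hT hp hF hDF u) h0 ht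
  have hgint := intervalIntegrable_of_memLp hp hg.1 h0 ht
  -- The derivative exists everywhere and is integrable, so this form of the fundamental theorem
  -- also covers p = 1.
  have hftc : ∫ s in (0 : ℝ)..t, (DF s).support u = (F t).support u - (F 0).support u :=
    intervalIntegral.integral_eq_sub_of_hasDerivAt_of_le ht.1
      (fun s hs => ((hder s (hsub hs)).continuousWithinAt).mono hsub)
      (fun s hs => (hder s (hsub (Ioo_subset_Icc_self hs))).hasDerivAt
        (Icc_mem_nhds hs.1 (hs.2.trans_le ht.2))) hint
  have hinner : inner ℝ u (∫ s in (0 : ℝ)..t, g s) = ∫ s in (0 : ℝ)..t, inner ℝ u (g s) := by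
    rw [intervalIntegral.integral_of_le ht.1, intervalIntegral.integral_of_le ht.1]
    exact (integral_inner hgint.1 u).symm
  have hle : ∫ s in (0 : ℝ)..t, inner ℝ u (g s) ≤ ∫ s in (0 : ℝ)..t, (DF s).support u := by
    refine intervalIntegral.integral_mono_ae_restrict ht.1 ?_ hint ?_
    · exact ⟨hgint.1.const_inner u, hgint.2.const_inner u⟩
    · filter_upwards [ae_restrict_of_ae_restrict_of_subset hsub hg.2] with s hs
      exact (DF s).inner_le_support u hs
  rw [inner_add_right, hinner]
  linarith [(F 0).inner_le_support u hx]

theorem mem_selectionsIS_of_primitive [CompleteSpace V] {p T : ℝ} (hT : 0 < T) (hp : 1 ≤ p)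
    {F DF : ℝ → ConvexBody V} {f g : ℝ → V} {x : V} (hF : F ∈ RieszBV T p)
    (hDF : ∀ t ∈ Icc 0 T, HasHukuharaDerivOn T F (DF t) t) (hx : x ∈ F 0)
    (hg : g ∈ selectionsLp T p DF) (hf : ∀ t ∈ Icc 0 T, f t = x + ∫ s in (0 : ℝ)..t, g s) :
    f ∈ selectionsIS T p F DF := by
  have hae := ae_derivWithin_primitive hT hp hg.1 hf
  refine ⟨⟨RieszBV.of_primitive hp hg.1 hf, fun t ht => ?_⟩, hg.1.ae_eq hae.symm, ?_⟩
  · rw [hf t ht]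
    exact add_integral_mem_of_hukuharaDeriv hT hp hF hDF hx hg ht
  · filter_upwards [hae, hg.2] with t h1 h2
    rwa [h1]

theorem isVpDecomposable_selectionsIS [CompleteSpace V] {p T : ℝ} (hT : 0 < T) (hp : 1 ≤ p)
    {F DF : ℝ → ConvexBody V} (hF : F ∈ RieszBV T p)
    (hDF : ∀ t ∈ Icc 0 T, HasHukuharaDerivOn T F (DF t) t) :
    IsVpDecomposable T p (selectionsIS T p F DF) := by
  refine ⟨fun f hf => hf.1.1, fun f₁ h₁ f₂ h₂ a ha => ?_⟩
  -- The concatenation is by definition the primitive from f₁ 0 of a function that switches between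
  -- two selections of DF.
  refine mem_selectionsIS_of_primitive hT hp hF hDF (h₁.1.2 0 (left_mem_Icc.2 hT.le))
    ⟨(h₁.2.1.indicator measurableSet_Ico).add (h₂.2.1.indicator measurableSet_Icc), ?_⟩
    fun t _ => rfl
  filter_upwards [h₁.2.2, h₂.2.2, ae_restrict_mem measurableSet_Icc] with s m₁ m₂ hs
  rcases lt_or_ge s a with h | h
  · rw [Pi.add_apply, indicator_of_mem (show s ∈ Ico 0 a from ⟨hs.1, h⟩),
      indicator_of_notMem (fun h' : s ∈ Icc a T => (h'.1.trans_lt h).false), add_zero]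
    exact m₁
  · rw [Pi.add_apply, indicator_of_notMem (fun h' : s ∈ Ico 0 a => (h.trans_lt h'.2).false),
      indicator_of_mem (show s ∈ Icc a T from ⟨h, hs.2⟩), zero_add]
    exact m₂

/-- Each coordinate of a point of DF t lies between -h(-bᵢ) and h(bᵢ), where h is the support
function of DF t; finitely many L^p functions therefore dominate the norm. -/
theorem integrablyBounded_hukuharaDeriv [FiniteDimensional ℝ V] {p T : ℝ} (hT : 0 < T)
    (hp : 1 ≤ p) {F DF : ℝ → ConvexBody V} (hF : F ∈ RieszBV T p)
    (hDF : ∀ t ∈ Icc 0 T, HasHukuharaDerivOn T F (DF t) t) : IntegrablyBounded T p DF := by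
  let b := stdOrthonormalBasis ℝ V
  have hL := memLp_support_hukuharaDeriv hT hp hF hDF
  refine ⟨fun t => ∑ i, (‖(DF t).support (b i)‖ + ‖(DF t).support (-b i)‖),
    memLp_finsetSum _ fun i _ => (hL (b i)).norm.add (hL (-b i)).norm, Eventually.of_forall
    fun t x hx => ?_⟩
  calc ‖x‖ = ‖∑ i, inner ℝ (b i) x • b i‖ := by rw [b.sum_repr' x]
    _ ≤ ∑ i, ‖inner ℝ (b i) x • b i‖ := norm_sum_le _ _
    _ ≤ _ := Finset.sum_le_sum fun i _ => by
      rw [norm_smul, b.norm_eq_one, mul_one, Real.norm_eq_abs, Real.norm_eq_abs, Real.norm_eq_abs]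
      have h1 := (DF t).inner_le_support (b i) hx
      have h2 := (DF t).inner_le_support (-b i) hx
      rw [inner_neg_left] at h2
      rw [abs_le]
      constructor <;>
        linarith [le_abs_self ((DF t).support (b i)), le_abs_self ((DF t).support (-b i)),
          abs_nonneg ((DF t).support (b i)), abs_nonneg ((DF t).support (-b i))]

theorem measurable_indicator_support_hukuharaDeriv {T : ℝ} (hT : 0 < T) {F DF : ℝ → ConvexBody V}
    (hDF : ∀ t ∈ Icc 0 T, HasHukuharaDerivOn T F (DF t) t) (u : V) :
    Measurable ((Ico 0 T).indicator fun t => (DF t).support u) := by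
  refine measurable_of_tendsto_metrizable (f := fun n : ℕ => (Ico 0 T).indicator
    (stepSlope (fun t => (F t).support u) (T / (n + 1 : ℕ))))
    (fun n => (stronglyMeasurable_stepSlope _ _).measurable.indicator measurableSet_Ico) ?_
  rw [tendsto_pi_nhds]
  intro t
  by_cases ht : t ∈ Ico 0 T
  · simp only [indicator_of_mem ht]
    have ht' := Ico_subset_Icc_self ht
    exact tendsto_stepSlope le_rfl ht ((hDF t ht').hasDerivWithinAt_support hT ht' u)
  · simp only [indicator_of_notMem ht]
    exact tendsto_const_nhds

/-- Grid cells are half-open, so the step slopes give no information at T; a single point does not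
affect measurability. -/
theorem measurableSet_of_inter_Ico {T : ℝ} {S : Set ℝ} (hS : S ⊆ Icc 0 T)
    (h : MeasurableSet (S ∩ Ico 0 T)) : MeasurableSet S := by
  rw [← inter_union_sdiff S (Ico 0 T)]
  refine h.union ((Set.subsingleton_singleton (a := T)).anti fun t ht => ?_).measurableSet
  by_contra hne
  exact ht.2 ⟨(hS ht.1).1, lt_of_le_of_ne (hS ht.1).2 hne⟩

theorem measurableBodies_hukuharaDeriv [FiniteDimensional ℝ V] {T : ℝ} (hT : 0 < T)
    {F DF : ℝ → ConvexBody V} (hDF : ∀ t ∈ Icc 0 T, HasHukuharaDerivOn T F (DF t) t) :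
    MeasurableBodies T DF := by
  have : CompleteSpace V := FiniteDimensional.complete ℝ V
  have hd := TopologicalSpace.denseRange_denseSeq V
  have hball (c : V) {r : ℝ} (hr : 0 ≤ r) :
      MeasurableSet {t | t ∈ Icc 0 T ∧ ((DF t : Set V) ∩ Metric.closedBall c r).Nonempty} := by
    apply measurableSet_of_inter_Ico (fun t ht => ht.1)
    -- Continuity of the support function in u lets a countable dense set of directions replace all
    -- of them.
    have heq : {t | t ∈ Icc 0 T ∧ ((DF t : Set V) ∩ Metric.closedBall c r).Nonempty} ∩ Ico 0 T =
        Ico 0 T ∩ ⋂ n : ℕ, {t | 0 ≤ (Ico 0 T).indicator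
          (fun t => (DF t).support (TopologicalSpace.denseSeq V n)) t -
            inner ℝ (TopologicalSpace.denseSeq V n) c + r * ‖TopologicalSpace.denseSeq V n‖} := by
      ext t
      rw [inter_comm, mem_inter_iff, mem_inter_iff]
      refine and_congr_right fun ht => ?_
      simp only [mem_ofPred_eq, mem_iInter, indicator_of_mem ht, Ico_subset_Icc_self ht, true_and,
        ConvexBody.inter_closedBall_nonempty_iff _ _ hr]
      refine ⟨fun h n => h _, fun h u => ?_⟩
      have hclosed : IsClosed {u : V | 0 ≤ (DF t).support u - inner ℝ u c + r * ‖u‖} :=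
        isClosed_le continuous_const (((DF t).continuous_support.sub (by fun_prop)).add
          (by fun_prop))
      exact hd.induction_on (p := fun u => 0 ≤ (DF t).support u - inner ℝ u c + r * ‖u‖)
        u hclosed h
    rw [heq]
    refine measurableSet_Ico.inter (MeasurableSet.iInter fun n => ?_)
    exact measurableSet_le measurable_const
      (((measurable_indicator_support_hukuharaDeriv hT hDF _).sub_const _).add_const _)
  intro U hU
  have heq : {t | t ∈ Icc 0 T ∧ ((DF t : Set V) ∩ U).Nonempty} =
      ⋃ (n : ℕ) (k : ℕ)
        (_ : Metric.closedBall (TopologicalSpace.denseSeq V n) (1 / ((k : ℝ) + 1)) ⊆ U),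
        {t | t ∈ Icc 0 T ∧ ((DF t : Set V) ∩
          Metric.closedBall (TopologicalSpace.denseSeq V n) (1 / ((k : ℝ) + 1))).Nonempty} := by
    ext t
    simp only [mem_ofPred_eq, mem_iUnion]
    constructor
    · rintro ⟨ht, x, hx, hxU⟩
      obtain ⟨ε, hε, hεU⟩ := Metric.isOpen_iff.1 hU x hxU
      obtain ⟨k, hk⟩ := exists_nat_one_div_lt (half_pos hε)
      -- Radius and distance of the centre to x are both below ε/2, so the closed ball contains x
      -- and stays in the ε-ball about x.
      obtain ⟨n, hn⟩ := hd.exists_dist_lt x (ε := 1 / ((k : ℝ) + 1)) (by positivity)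
      refine ⟨n, k, fun y hy => hεU ?_, ht, x, hx, hn.le⟩
      have hy : dist y _ ≤ _ := hy
      rw [Metric.mem_ball]
      linarith [dist_triangle_right y x (TopologicalSpace.denseSeq V n)]
    · rintro ⟨n, k, hsub, ht, x, hx, hxb⟩
      exact ⟨ht, x, hx, hsub hxb⟩
  rw [heq]
  exact MeasurableSet.iUnion fun n => MeasurableSet.iUnion fun k => MeasurableSet.iUnion fun _ =>
    hball _ (by positivity)

theorem isSetIntegral_selectionsIS [FiniteDimensional ℝ V] {p T : ℝ} (hT : 0 < T) (hp : 1 < p)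
    {F DF : ℝ → ConvexBody V} {x : V} (hF : F ∈ RieszBV T p)
    (hDF : ∀ t ∈ Icc 0 T, HasHukuharaDerivOn T F (DF t) t) (hF0 : (F 0 : Set V) = {x}) :
    IsSetIntegral T p (selectionsIS T p F DF) := by
  have : CompleteSpace V := FiniteDimensional.complete ℝ V
  refine ⟨x, DF, measurableBodies_hukuharaDeriv hT hDF,
    integrablyBounded_hukuharaDeriv hT hp.le hF hDF, Subset.antisymm ?_ ?_⟩
  · intro f hf
    refine ⟨hf.1.1, derivWithin f (Icc 0 T), hf.2, fun t ht => ?_⟩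
    have h0 : f 0 = x := by
      have : f 0 ∈ (F 0 : Set V) := hf.1.2 0 (left_mem_Icc.2 hT.le)
      rwa [hF0] at this
    rw [RieszBV.integral_deriv hT hp hf.1.1 (RieszBV.ae_hasDerivWithinAt hp.le hf.1.1) ht, h0,
      add_sub_cancel]
  · rintro f ⟨-, g, hg, hfg⟩
    refine mem_selectionsIS_of_primitive hT hp.le hF hDF ?_ hg hfg
    change x ∈ (F 0 : Set V)
    rw [hF0]
    exact mem_singleton x

end SetValued

end

theorem theorem4 (d : ℕ) (T p : ℝ) (hT : 0 < T) (hp : 1 ≤ p)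
    (F DF : ℝ → ConvexBody (EuclideanSpace ℝ (Fin d))) (x₀ : EuclideanSpace ℝ (Fin d))
    (hF : F ∈ RieszBV T p)
    (hDF : ∀ t ∈ Set.Icc 0 T, HasHukuharaDerivOn T F (DF t) t)
    (hF0 : (F 0 : Set (EuclideanSpace ℝ (Fin d))) = {x₀}) :
    IsVpDecomposable T p (selectionsIS T p F DF) ∧
      (1 < p → IsSetIntegral T p (selectionsIS T p F DF)) := by
  exact ⟨isVpDecomposable_selectionsIS hT hp hF hDF,
    fun hp1 => isSetIntegral_selectionsIS hT hp1 hF hDF hF0⟩
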